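/- **Self-adjointness of the bipartized operator on the PWIT.** Let $0<\alpha<2$, let $\theta$ be a probability measure on the unit circle $\mathbb S^1\subset\mathbb C$, and let $\ell_\theta$ be the measure on $\mathbb C$ given on Borel sets $D$ by $$\ell_\theta(D)=\int_0^\infty\int_{\mathbb S^1}\mathbf 1_{\{\omega^{-\alpha}r\in D\}}\,\theta(d\omega)\,dr .$$ Let $V=\mathbb N^f=\bigcup_{k\ge0}\mathbb N^k$ be the vertex set of the infinite rooted tree in which the offspring of $v$ are $v1,v2,\dots$. Consider a realization of $\mathrm{PWIT}(2\ell_\theta)$: there are independent Poisson point processes $(\Xi_v)_{v\in V}$ on $\mathbb C\times\{0,1\}$ with common intensity $2\ell_\theta\otimes\mathrm{Be}(1/2)$, where $\mathrm{Be}(1/2)=\frac12\delta_0+\frac12\delta_1$, and the points of $\Xi_v$, listed so that $|y_{v1}|\le|y_{v2}|\le\cdots$, are the marks $(y_{vk},\varepsilon_{vk})$ of the edges $\{v,vk\}$, $k\ge1$. For $v\in V$ and $k\ge 1$ set $$w_{v,vk}=\varepsilon_{vk}\,y_{vk}^{-1/\alpha},\qquad w_{vk,v}=(1-\varepsilon_{vk})\,y_{vk}^{-1/\alpha},$$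 and $w_{uv}=0$ for all other pairs. Here $\omega^{-\alpha}$ is the principal power, and $y_{vk}^{-1/\alpha}$ may be any value of the complex power, i.e. any number $e^{-l/\alpha}$ with $e^{l}=y_{vk}$, chosen separately for each edge (in particular the principal value; or, for $y_{vk}=\omega^{-\alpha}r$, the value $\omega r^{-1/\alpha}$). When $\sum_{v}(|w_{uv}|^2+|w_{vu}|^2)<\infty$ for every $u\in V$, let $A$ be the operator on the finitely supported vectors of $\ell^2(V)$ with $\langle\delta_u,A\delta_v\rangle=w_{uv}$. For $z\in\mathbb C$ let $B(z)$ be its bipartized operator: with $\hat V=\{\hat v:v\in V\}$ a disjoint copy of $V$ and $V^b=V\cup\hat V$, it is the symmetric operator on the finitely supported vectors of $\ell^2(V^b)$ with $$\langle\delta_u,B(z)\delta_{\hat v}\rangle=\overline{\langle\delta_{\hat v},B(z)\delta_u\rangle}=w_{uv}-z\mathbf 1_{\{u=v\}},\qquad \langle\delta_u,B(z)\delta_v\rangle=\langle\delta_{\hat u},B(z)\delta_{\hat v}\rangle=0\qquad(u,v\in V).$$ Then, with probability one: all marks $y_{vk}$ are nonzero and, for every such choice of the values of the powers, the summability condition holds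 (so that $A$ and $B(z)$ are well defined) and for all $z\in\mathbb C$ the closure of $B(z)$ is self-adjoint. -/

import Mathlib

open MeasureTheory ProbabilityTheory
open scoped ENNReal NNReal ComplexConjugate

/-! ### Operators on `ℓ²(W)` given by a matrix with square summable columns -/

/-- The Hilbert space `ℓ²(W)`. -/
abbrev Ell2 (W : Type*) : Type _ := lp (fun _ : W => ℂ) 2

/-- The subspace `𝒟(W)` of finitely supported vectors of `ℓ²(W)`. -/
def finSupp (W : Type*) : Submodule ℂ (Ell2 W) where
  carrier := {φ | (Function.support (φ : W → ℂ)).Finite}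
  zero_mem' := by
    change (Function.support (0 : W → ℂ)).Finite
    simp
  add_mem' {φ ψ} hφ hψ := by
    refine (Set.Finite.union hφ hψ).subset ?_
    rw [lp.coeFn_add]
    exact Function.support_add _ _
  smul_mem' c φ hφ := by
    refine Set.Finite.subset hφ ?_
    rw [lp.coeFn_smul]
    exact Function.support_const_smul_subset _ _

/-- The operator with domain `𝒟(W)` such that `⟨δ_p, T δ_q⟩ = b p q`, for a matrix `b` whose
columns are square summable: a finitely supported `φ` is sent to `∑ q, φ q • (b · q)`. -/
noncomputable def matrixOperator {W : Type*} (b : W → W → ℂ)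
    (hb : ∀ q, Memℓp (fun p => b p q) 2) : Ell2 W →ₗ.[ℂ] Ell2 W where
  domain := finSupp W
  toFun :=
    { toFun := fun φ =>
        ∑ᶠ q, (φ : Ell2 W) q • (⟨fun p => b p q, hb q⟩ : Ell2 W)
      map_add' := fun φ ψ => by
        rw [← finsum_add_distrib]
        · refine finsum_congr fun q => ?_
          rw [Submodule.coe_add, lp.coeFn_add, Pi.add_apply, add_smul]
        · exact φ.2.subset (fun q hq h => hq (by simp only [h, zero_smul]))
        · exact ψ.2.subset (fun q hq h => hq (by simp only [h, zero_smul]))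
      map_smul' := fun c φ => by
        rw [RingHom.id_apply, smul_finsum]
        refine finsum_congr fun q => ?_
        rw [Submodule.coe_smul, lp.coeFn_smul, Pi.smul_apply, smul_smul, smul_eq_mul] }

/-! ### Bipartization -/

/-- The standing assumption `∑_v |w_{uv}|² + |w_{vu}|² < ∞` for every `u`. -/
def SquareSummable {V : Type*} (w : V → V → ℂ) : Prop :=
  ∀ u, Summable fun v => ‖w u v‖ ^ 2 + ‖w v u‖ ^ 2

open Classical in
/-- The matrix of `B(z)` on `V ∪ V̂`; `Sum.inl u` stands for `u` and `Sum.inr v` for `v̂`. -/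
noncomputable def bipartizedMatrix {V : Type*} (w : V → V → ℂ) (z : ℂ) :
    V ⊕ V → V ⊕ V → ℂ
  | Sum.inl u, Sum.inr v => w u v - if u = v then z else 0
  | Sum.inr v, Sum.inl u => conj (w u v - if u = v then z else 0)
  | Sum.inl _, Sum.inl _ => 0
  | Sum.inr _, Sum.inr _ => 0

theorem memℓp_two_sub_single {V : Type*} [DecidableEq V] {f : V → ℂ}
    (hf : Summable fun v => ‖f v‖ ^ 2) (u : V) (z : ℂ) :
    Memℓp (fun v => f v - (Pi.single u z : V → ℂ) v) 2 := by
  have h1 : Memℓp f 2 := memℓp_gen (by simpa using hf)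
  exact h1.sub (lp.single 2 u z : Ell2 V).2

theorem memℓp_bipartizedMatrix {V : Type*} {w : V → V → ℂ} (hw : SquareSummable w) (z : ℂ)
    (q : V ⊕ V) : Memℓp (fun p => bipartizedMatrix w z p q) 2 := by
  classical
  have key : ∀ {f : V → ℂ}, Memℓp f 2 → Summable fun v => ‖f v‖ ^ 2 := fun {f} hf => by
    simpa using hf.summable (by simp)
  apply memℓp_gen
  rcases q with u | v
  · have h1 : Summable fun v => ‖w u v‖ ^ 2 :=
      (hw u).of_nonneg_of_le (fun _ => by positivity)
        (fun _ => le_add_of_nonneg_right (by positivity))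
    have h2 := key (memℓp_two_sub_single h1 u z)
    refine Summable.sum _ (by simp [Function.comp_def, bipartizedMatrix]) ?_
    refine h2.congr fun v => ?_
    by_cases h : u = v
    · subst h; simp [bipartizedMatrix, -map_sub]
    · simp [bipartizedMatrix, h, Ne.symm h]
  · have h1 : Summable fun u => ‖w u v‖ ^ 2 :=
      (hw v).of_nonneg_of_le (fun _ => by positivity)
        (fun _ => le_add_of_nonneg_left (by positivity))
    have h2 := key (memℓp_two_sub_single h1 v z)
    refine Summable.sum _ ?_ (by simp [Function.comp_def, bipartizedMatrix])
    refine h2.congr fun u => ?_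
    by_cases h : u = v
    · subst h; simp [bipartizedMatrix]
    · simp [bipartizedMatrix, h]

/-- The symmetric operator `B(z)` on `𝒟(V ∪ V̂)`, for the operator `A` on `𝒟(V)` with matrix
elements `⟨δ_u, A δ_v⟩ = w u v`. -/
noncomputable def bipartizedOperator {V : Type*} (w : V → V → ℂ) (hw : SquareSummable w)
    (z : ℂ) : Ell2 (V ⊕ V) →ₗ.[ℂ] Ell2 (V ⊕ V) :=
  matrixOperator (bipartizedMatrix w z) (memℓp_bipartizedMatrix hw z)

/-! ### Poisson point processes and the Poisson weighted infinite tree -/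

/-- The random measure `N` is a Poisson point process with intensity measure `μ`: the number of
points in a set of finite intensity is Poisson distributed, and the numbers of points in
disjoint sets are independent. -/
structure IsPoissonProcess {Ω E : Type*} [MeasurableSpace Ω] [MeasurableSpace E]
    (N : Ω → Measure E) (μ : Measure E) (P : Measure Ω) : Prop where
  measurable : Measurable N
  count_law : ∀ D : Set E, MeasurableSet D → μ D ≠ ∞ →
    P.map (fun x => N x D) = (poissonMeasure (μ D).toNNReal).map (Nat.cast : ℕ → ℝ≥0∞)
  indep : ∀ (n : ℕ) (D : Fin n → Set E), (∀ i, MeasurableSet (D i)) →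
    Pairwise (fun i j => Disjoint (D i) (D j)) → iIndepFun (fun i x => N x (D i)) P

/-- The Bernoulli distribution `½ δ₀ + ½ δ₁` on `{0, 1}`. -/
noncomputable def bernoulliHalf : Measure (Fin 2) :=
  (2⁻¹ : ℝ≥0∞) • Measure.dirac 0 + (2⁻¹ : ℝ≥0∞) • Measure.dirac 1

/-- Vertices of the infinite tree: finite words over `ℕ`. The root is `[]`, and the `k`-th
offspring of `v` is `k :: v` (words are written from right to left, offspring are numbered
from `0`). -/
abbrev Word : Type := List ℕ

/-- The family `ξ` is a realization of `PWIT(ρ)`: `ξ v k = (y_{vk}, ε_{vk})` is the mark of the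
edge between `v` and its `k`-th offspring. For each `v`, the marks `(ξ v k)_k` are the points,
ordered by increasing `|y_{vk}|`, of a Poisson point process with intensity `ρ ⊗ Be(1/2)`, and
these processes are independent for different `v`. -/
structure IsPWIT {Ω : Type*} [MeasurableSpace Ω] (ρ : Measure ℂ)
    (ξ : Word → ℕ → Ω → ℂ × Fin 2) (P : Measure Ω) : Prop where
  measurable : ∀ v k, Measurable (ξ v k)
  poisson : ∀ v, IsPoissonProcess (fun x => Measure.sum fun k => Measure.dirac (ξ v k x))
    (ρ.prod bernoulliHalf) P
  indep : iIndepFun (fun v x k => ξ v k x) P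
  ordered : ∀ᵐ x ∂P, ∀ v, Monotone fun k => ‖(ξ v k x).1‖

/-- The measure `ℓ_θ(D) = ∫_0^∞ ∫_{S¹} 1{ω^{-α} r ∈ D} θ(dω) dr` on `ℂ`. -/
noncomputable def ellTheta (α : ℝ) (θ : Measure (Metric.sphere (0 : ℂ) 1)) : Measure ℂ :=
  ((volume.restrict (Set.Ioi (0 : ℝ))).prod θ).map
    fun p => (p.2 : ℂ) ^ (-α : ℂ) * (p.1 : ℂ)

/-- `a` is one of the values of the (multivalued) complex power `y ^ s = exp (s log y)`,
`y ≠ 0`. -/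
def IsPowerValue (s y a : ℂ) : Prop :=
  ∃ l : ℂ, Complex.exp l = y ∧ a = Complex.exp (s * l)

/-- The matrix with entry `c v k` at `(v, vk)`, and zero entries at all other places. -/
noncomputable def offspringMatrix (c : Word → ℕ → ℂ) (u : Word) : Word → ℂ
  | [] => 0
  | k :: v => if v = u then c v k else 0

/-- The matrix elements `w_{v,vk} = ε_{vk} a_{vk}`, `w_{vk,v} = (1 - ε_{vk}) a_{vk}`, and
`w_{uv} = 0` if neither of `u`, `v` is an offspring of the other. -/
noncomputable def pwitWeight (a : Word → ℕ → ℂ) (ε : Word → ℕ → Fin 2) (u v : Word) : ℂ :=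
  offspringMatrix (fun v k => ((ε v k : ℕ) : ℂ) * a v k) u v
    + offspringMatrix (fun v k => (1 - ((ε v k : ℕ) : ℂ)) * a v k) v u

/-! ### Closures and adjoints of symmetric operators -/

/-! The closure of a densely defined symmetric operator is self-adjoint as soon as its adjoint is
symmetric. For a Hermitian matrix with square summable columns the adjoint still acts by the matrix
(`hasSum_adjoint_matrixOperator`), so its symmetry defect is the limit of the boundary terms in
Green's formula over finite sets `S` exhausting the index set. If every row in `S` has mass at most
`κ` outside `S`, and every outer index meets at most one index of `S`, Cauchy–Schwarz bounds these
terms by `√κ` times a norm times the square root of the `ℓ²` mass outside `S`. This tends to zero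
(`isSelfAdjoint_closure_matrixOperator`).

On the tree, a finite `S` containing the parents of its vertices meets each outer vertex only
through that vertex's parent. It remains to keep the edges leaving `S` light, with a bound uniform
in the vertex. A mark is heavy if its modulus is below 1/8, or if it lies in a dyadic shell holding
more than 16 times its expected number of points. The light marks at any vertex then satisfy a
deterministic bound on the sum of `‖y‖ ^ (-2/α)`, finite because `2/α > 1`
(`sum_norm_rpow_le_lightBound`). The expected number of heavy marks at a vertex is at most 2/3
(`tsum_measure_heavySet_le`), so heavy descendants form a subcritical branching process and are
almost surely finite in number (`ae_finite_isHeavyPath`). Closing a finite set under parents and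
heavy offspring therefore keeps it finite (`exists_finset_closed`). -/

theorem Submodule.adjoint_adjoint_le_topologicalClosure {𝕜 E F : Type*} [RCLike 𝕜]
    [NormedAddCommGroup E] [InnerProductSpace 𝕜 E] [CompleteSpace E]
    [NormedAddCommGroup F] [InnerProductSpace 𝕜 F] [CompleteSpace F]
    (g : Submodule 𝕜 (E × F)) : g.adjoint.adjoint ≤ g.topologicalClosure := by
  intro x hx
  -- With the `ℓ²` product norm the pairs form a Hilbert space, in which the double adjoint is a
  -- double orthogonal complement up to the rotation `(u, v) ↦ (v, -u)`.
  set e := (WithLp.linearEquiv 2 𝕜 (E × F)).symm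
  set g' : Submodule 𝕜 (WithLp 2 (E × F)) := g.map e.toLinearMap
  have h1 : e x ∈ g'ᗮᗮ := by
    rw [Submodule.mem_orthogonal]
    intro u hu
    rw [Submodule.mem_orthogonal] at hu
    have h2 : (u.snd, -u.fst) ∈ g.adjoint := by
      rw [Submodule.mem_adjoint_iff]
      intro a b hab
      have h3 := hu (e (a, b)) ⟨(a, b), hab, rfl⟩
      rw [WithLp.prod_inner_apply] at h3
      simp only [inner_neg_right, sub_neg_eq_add]
      rw [add_comm]
      exact h3
    have h4 := (Submodule.mem_adjoint_iff _ _).1 hx _ _ h2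
    rw [WithLp.prod_inner_apply]
    rw [inner_neg_left, ← neg_add', neg_eq_zero] at h4
    exact h4
  rw [Submodule.orthogonal_orthogonal_eq_closure] at h1
  change e x ∈ closure (e '' (g : Set (E × F))) at h1
  change x ∈ closure (g : Set (E × F))
  have h5 : Continuous (WithLp.linearEquiv 2 𝕜 (E × F)) := WithLp.prod_continuous_ofLp _ _ _
  have h6 := image_closure_subset_closure_image h5 ⟨_, h1, rfl⟩
  rw [Set.image_image] at h6
  simpa [e] using h6

-- The inclusions `T* ≤ T** ≤ closure T ≤ T*` force equality throughout; the first is symmetry of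
-- `T*`, the last is symmetry of `T` and closedness of `T*`.
open LinearPMap in
theorem LinearPMap.isSelfAdjoint_closure_of_isFormalAdjoint {𝕜 E : Type*} [RCLike 𝕜]
    [NormedAddCommGroup E] [InnerProductSpace 𝕜 E] [CompleteSpace E] {T : E →ₗ.[𝕜] E}
    (hT : Dense (T.domain : Set E)) (hsymm : T.IsFormalAdjoint T)
    (hadj : T.adjoint.IsFormalAdjoint T.adjoint) : IsSelfAdjoint T.closure := by
  have hle : T ≤ T.adjoint := hsymm.le_adjoint hT
  have hT' : Dense (T.adjoint.domain : Set E) := hT.mono hle.1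
  have hcl : T.IsClosable := (adjoint_isClosed hT).isClosable.leIsClosable hle
  have h1 : T.adjoint ≤ T.adjoint.adjoint := hadj.le_adjoint hT'
  have h2 : T.adjoint.adjoint.graph ≤ T.closure.graph := by
    rw [adjoint_graph_eq_graph_adjoint hT', adjoint_graph_eq_graph_adjoint hT,
      ← hcl.graph_closure_eq_closure_graph]
    exact Submodule.adjoint_adjoint_le_topologicalClosure _
  have h3 : T.closure ≤ T.adjoint := by
    have := (adjoint_isClosed hT).isClosable.closure_mono hle
    have h4 : (T.adjoint).closure = T.adjoint := by
      apply LinearPMap.eq_of_eq_graph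
      rw [← (adjoint_isClosed hT).isClosable.graph_closure_eq_closure_graph]
      exact (adjoint_isClosed hT).submodule_topologicalClosure_eq
    rwa [h4] at this
  have h5 : T.adjoint.adjoint ≤ T.closure := LinearPMap.le_of_le_graph h2
  have h6 : T.closure = T.adjoint := le_antisymm h3 (h1.trans h5)
  rw [isSelfAdjoint_def, h6]
  exact le_antisymm (h5.trans h3) h1

/-! ### Hermitian matrices with square summable columns -/

theorem dense_finSupp (W : Type*) : Dense (finSupp W : Set (Ell2 W)) := by
  classical
  intro f
  refine mem_closure_of_tendsto (lp.hasSum_single (by simp) f) (Filter.Eventually.of_forall ?_)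
  intro s
  refine Submodule.sum_mem (finSupp W) fun i _ => ?_
  refine (Set.finite_singleton i).subset fun j hj => ?_
  by_contra h
  exact hj (by rw [lp.single_apply]; exact Pi.single_eq_of_ne h _)

section Hermitian

variable {W : Type*} {b : W → W → ℂ} (hb : ∀ q, Memℓp (fun p => b p q) 2)

theorem matrixOperator_apply_eq_sum (φ : finSupp W) (F : Finset W)
    (hF : Function.support ((φ : Ell2 W) : W → ℂ) ⊆ F) :
    matrixOperator b hb φ = ∑ q ∈ F, (φ : Ell2 W) q • (⟨fun p => b p q, hb q⟩ : Ell2 W) := by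
  change (∑ᶠ q, (φ : Ell2 W) q • (⟨fun p => b p q, hb q⟩ : Ell2 W)) = _
  refine finsum_eq_sum_of_support_subset _ fun q hq => hF fun h => hq ?_
  simp only [h, zero_smul]

theorem inner_matrixOperator_apply (φ : finSupp W) (F : Finset W)
    (hF : Function.support ((φ : Ell2 W) : W → ℂ) ⊆ F) (ψ : Ell2 W) :
    inner ℂ (matrixOperator b hb φ) ψ =
      ∑ q ∈ F, conj ((φ : Ell2 W) q) * ∑' p, conj (b p q) * ψ p := by
  rw [matrixOperator_apply_eq_sum hb φ F hF, sum_inner]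
  refine Finset.sum_congr rfl fun q _ => ?_
  rw [inner_smul_left, lp.inner_eq_tsum]
  congr 1
  refine tsum_congr fun p => ?_
  rw [RCLike.inner_apply, mul_comm]

theorem isFormalAdjoint_matrixOperator (hH : ∀ p q, conj (b p q) = b q p) :
    (matrixOperator b hb).IsFormalAdjoint (matrixOperator b hb) := by
  classical
  intro φ ψ
  set F := Set.Finite.toFinset φ.2 ∪ Set.Finite.toFinset ψ.2
  have hφ : Function.support ((φ : Ell2 W) : W → ℂ) ⊆ F := fun q hq => by
    simp only [F, Finset.coe_union]; exact Or.inl ((Set.Finite.mem_toFinset _).2 hq)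
  have hψ : Function.support ((ψ : Ell2 W) : W → ℂ) ⊆ F := fun q hq => by
    simp only [F, Finset.coe_union]; exact Or.inr ((Set.Finite.mem_toFinset _).2 hq)
  have key : ∀ φ ψ : finSupp W, Function.support ((φ : Ell2 W) : W → ℂ) ⊆ F →
      Function.support ((ψ : Ell2 W) : W → ℂ) ⊆ F →
      inner ℂ (matrixOperator b hb φ) (ψ : Ell2 W) =
      ∑ q ∈ F, ∑ p ∈ F, conj ((φ : Ell2 W) q) * (conj (b p q) * (ψ : Ell2 W) p) := by
    intro φ ψ hφ hψ
    rw [inner_matrixOperator_apply hb φ F hφ]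
    refine Finset.sum_congr rfl fun q _ => ?_
    rw [← Finset.mul_sum]
    congr 1
    refine tsum_eq_sum fun p hp => ?_
    have : (ψ : Ell2 W) p = 0 := by
      by_contra h
      exact hp (hψ h)
    rw [this, mul_zero]
  rw [key φ ψ hφ hψ, ← inner_conj_symm (φ : Ell2 W), key ψ φ hψ hφ, map_sum, Finset.sum_comm]
  refine Finset.sum_congr rfl fun p _ => ?_
  rw [map_sum]
  refine Finset.sum_congr rfl fun q _ => ?_
  simp only [map_mul, RCLike.conj_conj, hH]
  ring

-- Pair with the basis vector at `p`, which lies in the domain; `φ` itself need not have finite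
-- support.
open LinearPMap in
theorem hasSum_adjoint_matrixOperator (hH : ∀ p q, conj (b p q) = b q p)
    (φ : (matrixOperator b hb).adjoint.domain) (p : W) :
    HasSum (fun q => b p q * (φ : Ell2 W) q) (((matrixOperator b hb).adjoint φ : Ell2 W) p) := by
  classical
  have hd : lp.single 2 p (1 : ℂ) ∈ finSupp W := by
    refine (Set.finite_singleton p).subset fun j hj => ?_
    by_contra h
    exact hj (by rw [lp.single_apply]; exact Pi.single_eq_of_ne h _)
  let δ : finSupp W := ⟨_, hd⟩
  have h1 : inner ℂ (matrixOperator b hb δ) (φ : Ell2 W) =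
      inner ℂ (lp.single 2 p (1 : ℂ) : Ell2 W) ((matrixOperator b hb).adjoint φ) :=
    (adjoint_isFormalAdjoint (T := matrixOperator b hb) (dense_finSupp W)).symm δ φ
  have h2 : matrixOperator b hb δ = (⟨fun q => b q p, hb p⟩ : Ell2 W) := by
    rw [matrixOperator_apply_eq_sum hb δ {p}]
    · simp [δ]
    · intro j hj
      by_contra h
      refine hj ?_
      change (lp.single 2 p (1 : ℂ) : Ell2 W) j = 0
      rw [lp.single_apply]
      exact Pi.single_eq_of_ne (by simpa using h) _
  rw [h2, lp.inner_single_left] at h1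
  have h3 := lp.hasSum_inner (𝕜 := ℂ) (⟨fun q => b q p, hb p⟩ : Ell2 W) (φ : Ell2 W)
  rw [h1] at h3
  simp only [RCLike.inner_apply, map_one, mul_one] at h3
  have h4 : (fun q => b p q * (φ : Ell2 W) q) = fun q => (φ : Ell2 W) q * conj (b q p) := by
    funext q
    rw [hH, mul_comm]
  rwa [h4]

end Hermitian

section Criterion

theorem Ell2.hasSum_norm_sq {W : Type*} (φ : Ell2 W) :
    HasSum (fun q => ‖φ q‖ ^ 2) (‖φ‖ ^ 2) := by
  simpa using lp.hasSum_norm (p := 2) (by simp) φ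

theorem Ell2.sum_norm_sq_le {W : Type*} (φ : Ell2 W) (F : Finset W) :
    ∑ q ∈ F, ‖φ q‖ ^ 2 ≤ ‖φ‖ ^ 2 :=
  sum_le_hasSum F (fun _ _ => by positivity) (Ell2.hasSum_norm_sq φ)

/-- The finite set `S` has a thin boundary for the matrix `b`: the rows in `S` have little mass
outside of `S`, and each index outside of `S` interacts with at most one index in `S`. -/
def HasThinBoundary {W : Type*} (b : W → W → ℂ) (κ : ℝ) (S : Finset W) : Prop :=
  (∀ p ∈ S, ∀ G : Finset W, Disjoint S G → ∑ q ∈ G, ‖b p q‖ ^ 2 ≤ κ) ∧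
    ∀ q ∉ S, ∀ p ∈ S, ∀ p' ∈ S, b p q ≠ 0 → b p' q ≠ 0 → p = p'

variable {W : Type*} {b : W → W → ℂ} {κ : ℝ} {S : Finset W}

/-- Cauchy–Schwarz over the pairs `(p, q)`: the row bound controls the factor `ψ p * b p q`, and the
single-neighbour condition controls the factor `φ q`. -/
theorem HasThinBoundary.norm_sum_le (hS : HasThinBoundary b κ S) (hκ : 0 ≤ κ)
    {G : Finset W} (hG : Disjoint S G) (ψ φ : Ell2 W) :
    ‖∑ p ∈ S, ∑ q ∈ G, conj (ψ p) * (b p q * φ q)‖ ≤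
      √κ * ‖ψ‖ * √(‖φ‖ ^ 2 - ∑ q ∈ S, ‖φ q‖ ^ 2) := by
  classical
  -- Restricting to nonzero entries ensures that each `q` is counted at most once in the sum of `g ^
  -- 2`.
  set g : W × W → ℝ := fun x => if b x.1 x.2 ≠ 0 then ‖φ x.2‖ else 0
  have h1 : ‖∑ p ∈ S, ∑ q ∈ G, conj (ψ p) * (b p q * φ q)‖ ≤
      ∑ x ∈ S ×ˢ G, (‖ψ x.1‖ * ‖b x.1 x.2‖) * g x := by
    rw [← Finset.sum_product']
    refine norm_sum_le_of_le _ fun x _ => ?_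
    by_cases hx : b x.1 x.2 = 0
    · simp [hx]
    · simp [g, hx, mul_assoc]
  refine h1.trans ((Real.sum_mul_le_sqrt_mul_sqrt _ _ _).trans ?_)
  refine mul_le_mul ?_ ?_ (Real.sqrt_nonneg _) (by positivity)
  · rw [← Real.sqrt_sq (norm_nonneg ψ), ← Real.sqrt_mul hκ]
    refine Real.sqrt_le_sqrt ?_
    rw [Finset.sum_product]
    calc ∑ p ∈ S, ∑ q ∈ G, (‖ψ p‖ * ‖b p q‖) ^ 2 ≤ ∑ p ∈ S, κ * ‖ψ p‖ ^ 2 := by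
          refine Finset.sum_le_sum fun p hp => ?_
          simp only [mul_pow]
          rw [← Finset.mul_sum, mul_comm]
          exact mul_le_mul_of_nonneg_right (hS.1 p hp G hG) (by positivity)
      _ ≤ κ * ‖ψ‖ ^ 2 := by
          rw [← Finset.mul_sum]
          exact mul_le_mul_of_nonneg_left (Ell2.sum_norm_sq_le ψ S) hκ
  · refine Real.sqrt_le_sqrt ?_
    rw [Finset.sum_product_right, le_sub_iff_add_le]
    calc ∑ q ∈ G, ∑ p ∈ S, g (p, q) ^ 2 + ∑ q ∈ S, ‖φ q‖ ^ 2
        ≤ ∑ q ∈ G, ‖φ q‖ ^ 2 + ∑ q ∈ S, ‖φ q‖ ^ 2 := by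
          refine add_le_add_left (Finset.sum_le_sum fun q hq => ?_) _
          have hqS : q ∉ S := Finset.disjoint_right.1 hG hq
          have h2 : ∀ p ∈ S, g (p, q) ^ 2 = if b p q ≠ 0 then ‖φ q‖ ^ 2 else 0 := by
            intro p _
            by_cases hx : b p q = 0 <;> simp [g, hx]
          rw [Finset.sum_congr rfl h2, ← Finset.sum_filter, Finset.sum_const, nsmul_eq_mul]
          refine mul_le_of_le_one_left (by positivity) ?_
          norm_cast
          rw [Finset.card_le_one]
          intro p hp p' hp'
          rw [Finset.mem_filter] at hp hp'
          exact hS.2 q hqS p hp.1 p' hp'.1 hp.2 hp'.2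
      _ = ∑ q ∈ G ∪ S, ‖φ q‖ ^ 2 := (Finset.sum_union hG.symm).symm
      _ ≤ ‖φ‖ ^ 2 := Ell2.sum_norm_sq_le φ _

/-- Green's formula on a finite set with a thin boundary. -/
theorem HasThinBoundary.norm_green_le (hS : HasThinBoundary b κ S) (hκ : 0 ≤ κ)
    (hH : ∀ p q, conj (b p q) = b q p) (ψ φ ψ' φ' : Ell2 W)
    (hψ : ∀ p, HasSum (fun q => b p q * ψ q) (ψ' p))
    (hφ : ∀ p, HasSum (fun q => b p q * φ q) (φ' p)) :
    ‖∑ p ∈ S, (conj (ψ p) * φ' p - conj (ψ' p) * φ p)‖ ≤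
      √κ * ‖ψ‖ * √(‖φ‖ ^ 2 - ∑ q ∈ S, ‖φ q‖ ^ 2) +
        √κ * ‖φ‖ * √(‖ψ‖ ^ 2 - ∑ q ∈ S, ‖ψ q‖ ^ 2) := by
  classical
  -- The rows are truncated to finite `G ⊇ S`; the bound does not depend on `G`.
  have hlim : Filter.Tendsto (fun G : Finset W =>
      ‖∑ p ∈ S, (conj (ψ p) * (∑ q ∈ G, b p q * φ q) -
        conj (∑ q ∈ G, b p q * ψ q) * φ p)‖) Filter.atTop
      (nhds ‖∑ p ∈ S, (conj (ψ p) * φ' p - conj (ψ' p) * φ p)‖) := by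
    refine (tendsto_finsetSum _ fun p _ => ?_).norm
    refine ((hφ p).const_mul _).sub (Filter.Tendsto.mul_const _ ?_)
    exact (Complex.continuous_conj.tendsto _).comp (hψ p)
  refine le_of_tendsto hlim ?_
  filter_upwards [Filter.eventually_ge_atTop S] with G hG
  have hdis : Disjoint S (G \ S) := Finset.disjoint_sdiff
  -- By Hermitian symmetry the interior terms cancel, leaving only pairs that cross the boundary.
  have hzero : ∑ p ∈ S, ∑ q ∈ S, conj (ψ p) * (b p q * φ q) =
      ∑ p ∈ S, ∑ q ∈ S, conj (b p q * ψ q) * φ p := by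
    rw [Finset.sum_comm]
    refine Finset.sum_congr rfl fun p _ => Finset.sum_congr rfl fun q _ => ?_
    rw [map_mul, hH]
    ring
  have hsplit : ∑ p ∈ S, (conj (ψ p) * (∑ q ∈ G, b p q * φ q) -
        conj (∑ q ∈ G, b p q * ψ q) * φ p) =
      ∑ p ∈ S, ∑ q ∈ G \ S, conj (ψ p) * (b p q * φ q) -
        conj (∑ p ∈ S, ∑ q ∈ G \ S, conj (φ p) * (b p q * ψ q)) := by
    have e1 : ∑ p ∈ S, conj (ψ p) * (∑ q ∈ G, b p q * φ q) =
        ∑ p ∈ S, ∑ q ∈ G \ S, conj (ψ p) * (b p q * φ q) +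
          ∑ p ∈ S, ∑ q ∈ S, conj (ψ p) * (b p q * φ q) := by
      rw [← Finset.sum_add_distrib]
      refine Finset.sum_congr rfl fun p _ => ?_
      rw [Finset.sum_sdiff hG, Finset.mul_sum]
    have e2 : ∑ p ∈ S, conj (∑ q ∈ G, b p q * ψ q) * φ p =
        conj (∑ p ∈ S, ∑ q ∈ G \ S, conj (φ p) * (b p q * ψ q)) +
          ∑ p ∈ S, ∑ q ∈ S, conj (b p q * ψ q) * φ p := by
      rw [map_sum, ← Finset.sum_add_distrib]
      refine Finset.sum_congr rfl fun p _ => ?_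
      rw [← Finset.sum_mul, ← map_sum, ← Finset.mul_sum, map_mul, RCLike.conj_conj,
        mul_comm (φ p), ← add_mul, ← map_add, Finset.sum_sdiff hG]
    rw [Finset.sum_sub_distrib, e1, e2, hzero, add_sub_add_right_eq_sub]
  rw [hsplit]
  refine (norm_sub_le _ _).trans ?_
  rw [RCLike.norm_conj]
  exact add_le_add (hS.norm_sum_le hκ hdis ψ φ) (hS.norm_sum_le hκ hdis φ ψ)

/-- A Hermitian matrix with square summable columns defines an essentially self-adjoint operator
if the index set is exhausted by finite sets with uniformly thin boundaries. -/
theorem isSelfAdjoint_closure_matrixOperator (hb : ∀ q, Memℓp (fun p => b p q) 2)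
    (hH : ∀ p q, conj (b p q) = b q p) (hκ : 0 ≤ κ)
    (hex : ∀ F : Finset W, ∃ S, F ⊆ S ∧ HasThinBoundary b κ S) :
    IsSelfAdjoint (matrixOperator b hb).closure := by
  refine LinearPMap.isSelfAdjoint_closure_of_isFormalAdjoint (dense_finSupp W)
    (isFormalAdjoint_matrixOperator hb hH) fun ψ φ => ?_
  set ψ' := (matrixOperator b hb).adjoint ψ
  set φ' := (matrixOperator b hb).adjoint φ
  choose S hFS hS using hex
  have hSt : Filter.Tendsto S Filter.atTop Filter.atTop :=
    Filter.tendsto_atTop_mono hFS Filter.tendsto_id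
  have hR : ∀ φ : Ell2 W, Filter.Tendsto
      (fun F => √(‖φ‖ ^ 2 - ∑ q ∈ S F, ‖φ q‖ ^ 2)) Filter.atTop (nhds 0) := by
    intro φ
    have h1 : Filter.Tendsto (fun F => ∑ q ∈ S F, ‖φ q‖ ^ 2) Filter.atTop (nhds (‖φ‖ ^ 2)) :=
      (show Filter.Tendsto (fun F : Finset W => ∑ q ∈ F, ‖φ q‖ ^ 2) Filter.atTop _ from
        Ell2.hasSum_norm_sq φ).comp hSt
    have h2 := (h1.const_sub (‖φ‖ ^ 2)).sqrt
    have h3 : √(‖φ‖ ^ 2 - ‖φ‖ ^ 2) = 0 := by rw [sub_self, Real.sqrt_zero]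
    rwa [h3] at h2
  have hgreen := fun F => (hS F).norm_green_le hκ hH (ψ : Ell2 W) (φ : Ell2 W) ψ' φ'
    (hasSum_adjoint_matrixOperator hb hH ψ) (hasSum_adjoint_matrixOperator hb hH φ)
  have hbd : Filter.Tendsto (fun F => √κ * ‖(ψ : Ell2 W)‖ *
      √(‖(φ : Ell2 W)‖ ^ 2 - ∑ q ∈ S F, ‖(φ : Ell2 W) q‖ ^ 2) + √κ * ‖(φ : Ell2 W)‖ *
        √(‖(ψ : Ell2 W)‖ ^ 2 - ∑ q ∈ S F, ‖(ψ : Ell2 W) q‖ ^ 2)) Filter.atTop (nhds 0) := by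
    simpa using ((hR φ).const_mul (√κ * ‖(ψ : Ell2 W)‖)).add
      ((hR ψ).const_mul (√κ * ‖(φ : Ell2 W)‖))
  have hzero := squeeze_zero_norm hgreen hbd
  have hsum : HasSum (fun p => conj ((ψ : Ell2 W) p) * φ' p - conj (ψ' p) * (φ : Ell2 W) p)
      (inner ℂ (ψ : Ell2 W) φ' - inner ℂ ψ' (φ : Ell2 W)) := by
    have h1 := (lp.hasSum_inner (𝕜 := ℂ) (ψ : Ell2 W) φ').sub
      (lp.hasSum_inner (𝕜 := ℂ) ψ' (φ : Ell2 W))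
    simpa only [RCLike.inner_apply, mul_comm] using h1
  have h2 := tendsto_nhds_unique (hsum.comp hSt) hzero
  exact (sub_eq_zero.1 h2).symm

end Criterion

/-! ### The weights on the tree -/

theorem offspringMatrix_cons_self (c : Word → ℕ → ℂ) (u : Word) (k : ℕ) :
    offspringMatrix c u (k :: u) = c u k := by
  simp [offspringMatrix]

theorem offspringMatrix_ne_zero {c : Word → ℕ → ℂ} {u v : Word} (h : offspringMatrix c u v ≠ 0) :
    ∃ k, v = k :: u := by
  rcases v with _ | ⟨k, v⟩
  · exact absurd rfl h
  · refine ⟨k, ?_⟩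
    by_contra h'
    exact h (if_neg fun e => h' (by rw [e]))

theorem offspringMatrix_cons_left (c : Word → ℕ → ℂ) (u : Word) (k : ℕ) :
    offspringMatrix c (k :: u) u = 0 := by
  by_contra h
  obtain ⟨j, hj⟩ := offspringMatrix_ne_zero h
  have := congrArg List.length hj
  simp only [List.length_cons] at this
  omega

section Weights

variable (a : Word → ℕ → ℂ) (ε : Word → ℕ → Fin 2)

theorem pwitWeight_self_cons (u : Word) (k : ℕ) :
    pwitWeight a ε u (k :: u) = ((ε u k : ℕ) : ℂ) * a u k := by
  rw [pwitWeight, offspringMatrix_cons_self, offspringMatrix_cons_left, add_zero]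

theorem pwitWeight_cons_self (u : Word) (k : ℕ) :
    pwitWeight a ε (k :: u) u = (1 - ((ε u k : ℕ) : ℂ)) * a u k := by
  rw [pwitWeight, offspringMatrix_cons_self, offspringMatrix_cons_left, zero_add]

variable {a ε} in
theorem pwitWeight_ne_zero {u v : Word} (h : pwitWeight a ε u v ≠ 0) :
    (∃ k, v = k :: u) ∨ ∃ k, u = k :: v := by
  by_contra! h'
  refine h ?_
  rw [pwitWeight]
  have h1 : ∀ c, offspringMatrix c u v = 0 := fun c => by
    by_contra h2
    obtain ⟨k, hk⟩ := offspringMatrix_ne_zero h2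
    exact h'.1 k hk
  have h3 : ∀ c, offspringMatrix c v u = 0 := fun c => by
    by_contra h2
    obtain ⟨k, hk⟩ := offspringMatrix_ne_zero h2
    exact h'.2 k hk
  rw [h1, h3, add_zero]

theorem norm_pwitWeight_self_cons_le (u : Word) (k : ℕ) :
    ‖pwitWeight a ε u (k :: u)‖ ≤ ‖a u k‖ := by
  rw [pwitWeight_self_cons]
  generalize ε u k = e
  fin_cases e <;> simp

theorem norm_pwitWeight_cons_self_le (u : Word) (k : ℕ) :
    ‖pwitWeight a ε (k :: u) u‖ ≤ ‖a u k‖ := by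
  rw [pwitWeight_cons_self]
  generalize ε u k = e
  fin_cases e <;> simp

variable {a}

theorem squareSummable_pwitWeight (ha : ∀ u, Summable fun k => ‖a u k‖ ^ 2) :
    SquareSummable (pwitWeight a ε) := by
  intro u
  set f : Word → ℝ := fun v => ‖pwitWeight a ε u v‖ ^ 2 + ‖pwitWeight a ε v u‖ ^ 2
  have h0 : ∀ v, v ≠ u.tail → v ∉ Set.range (fun k : ℕ => k :: u) → f v = 0 := by
    intro v hv hv'
    have h1 : ¬ ((∃ k, v = k :: u) ∨ ∃ k, u = k :: v) := by
      rintro (⟨k, rfl⟩ | ⟨k, rfl⟩)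
      · exact hv' ⟨k, rfl⟩
      · exact hv rfl
    have h2 : pwitWeight a ε u v = 0 := not_not.1 fun h => h1 (pwitWeight_ne_zero h)
    have h3 : pwitWeight a ε v u = 0 := not_not.1 fun h => h1 (pwitWeight_ne_zero h).symm
    simp [f, h2, h3]
  -- The parent is a single term and does not affect summability. At the root `u.tail` is the root
  -- itself, which is harmless.
  set f' : Word → ℝ := fun v => if v = u.tail then 0 else f v
  have hinj : Function.Injective (fun k : ℕ => k :: u) := fun i j h => (List.cons.inj h).1
  have hf' : Summable f' := by
    rw [← hinj.summable_iff]
    · refine ((ha u).mul_left 2).of_nonneg_of_le (fun k => ?_) fun k => ?_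
      · simp only [Function.comp, f']
        split_ifs <;> positivity
      · simp only [Function.comp, f']
        split_ifs
        · positivity
        · rw [two_mul]
          exact add_le_add
            (pow_le_pow_left₀ (norm_nonneg _) (norm_pwitWeight_self_cons_le a ε u k) 2)
            (pow_le_pow_left₀ (norm_nonneg _) (norm_pwitWeight_cons_self_le a ε u k) 2)
    · intro v hv
      by_cases h : v = u.tail
      · simp [f', h]
      · simp [f', h, h0 v h hv]
  refine hf'.congr_cofinite ?_
  refine (Set.finite_singleton u.tail).subset fun v hv => ?_
  by_contra h
  exact hv (if_neg h)

end Weights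

/-! ### Heavy paths -/

/-- All steps of the path from `v` to its descendant `s ++ v` are in `h`. -/
def IsHeavyPath (h : Word → ℕ → Prop) (v : Word) : Word → Prop
  | [] => True
  | k :: s => IsHeavyPath h v s ∧ h (s ++ v) k

/-- Take all endpoints of heavy paths issued from the ancestors of `F`, which are the suffixes of
its words. Dropping the last step of a heavy path leaves a heavy path, which gives closure under
parents. -/
theorem exists_finset_closed {h : Word → ℕ → Prop} (hfin : ∀ v, {s | IsHeavyPath h v s}.Finite)
    (F : Finset Word) : ∃ S : Finset Word, F ⊆ S ∧ (∀ k v, k :: v ∈ S → v ∈ S) ∧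
      ∀ v ∈ S, ∀ k, h v k → k :: v ∈ S := by
  classical
  set T : Set Word :=
    ⋃ f ∈ F, ⋃ t ∈ f.tails.toFinset, (fun s => s ++ t) '' {s | IsHeavyPath h t s}
  have hT : T.Finite := F.finite_toSet.biUnion fun f _ =>
    (Finset.finite_toSet _).biUnion fun t _ => (hfin t).image _
  have hmem : ∀ v, v ∈ hT.toFinset ↔ ∃ f ∈ F, ∃ t, t <:+ f ∧ ∃ s, IsHeavyPath h t s ∧ s ++ t = v := by
    intro v
    simp [T]
  refine ⟨hT.toFinset, fun f hf => ?_, fun k v hv => ?_, fun v hv k hk => ?_⟩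
  · exact (hmem f).2 ⟨f, hf, f, List.suffix_refl f, [], trivial, rfl⟩
  · obtain ⟨f, hf, t, ht, s, hs, hst⟩ := (hmem _).1 hv
    rcases s with _ | ⟨j, s⟩
    · refine (hmem v).2 ⟨f, hf, v, ?_, [], trivial, rfl⟩
      rw [List.nil_append] at hst
      subst hst
      exact (List.suffix_cons k v).trans ht
    · rw [List.cons_append, List.cons.injEq] at hst
      exact (hmem v).2 ⟨f, hf, t, ht, s, hs.1, hst.2⟩
  · obtain ⟨f, hf, t, ht, s, hs, hst⟩ := (hmem _).1 hv
    refine (hmem _).2 ⟨f, hf, t, ht, k :: s, ⟨hs, ?_⟩, ?_⟩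
    · rwa [hst]
    · rw [List.cons_append, hst]

/-! ### The bipartized operator on the tree -/

section Bipartized

theorem conj_bipartizedMatrix {V : Type*} (w : V → V → ℂ) (z : ℂ) (p q : V ⊕ V) :
    conj (bipartizedMatrix w z p q) = bipartizedMatrix w z q p := by
  rcases p with u | u <;> rcases q with v | v <;> simp [bipartizedMatrix, -map_sub]

variable {a : Word → ℕ → ℂ} {ε : Word → ℕ → Fin 2} {h : Word → ℕ → Prop} {κ : ℝ}

/-- An edge leaving the set goes from a vertex to a light offspring, on the opposite side of the
bipartition. The entries containing `z` join `u` to `û`, and both copies of `S` are taken, so they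
never cross the boundary. -/
theorem hasThinBoundary_bipartizedMatrix
    (hκ : ∀ u, ∀ K : Finset ℕ, (∀ k ∈ K, ¬ h u k) → ∑ k ∈ K, ‖a u k‖ ^ 2 ≤ κ)
    {S : Finset Word} (hparent : ∀ k v, k :: v ∈ S → v ∈ S)
    (hheavy : ∀ v ∈ S, ∀ k, h v k → k :: v ∈ S) (z : ℂ) :
    HasThinBoundary (bipartizedMatrix (pwitWeight a ε) z) κ (S.disjSum S) := by
  classical
  have hstep : ∀ u ∈ S, ∀ v ∉ S, (pwitWeight a ε u v ≠ 0 ∨ pwitWeight a ε v u ≠ 0) →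
      ∃ k, v = k :: u := by
    intro u hu v hv hw
    have h1 : (∃ k, v = k :: u) ∨ ∃ k, u = k :: v :=
      hw.elim pwitWeight_ne_zero fun h => (pwitWeight_ne_zero h).symm
    rcases h1 with h1 | ⟨k, rfl⟩
    · exact h1
    · exact absurd (hparent k v hu) hv
  have hne : ∀ u ∈ S, ∀ v ∉ S, u ≠ v := fun u hu v hv e => hv (e ▸ hu)
  have hmatrix : ∀ p ∈ S.disjSum S, ∀ q ∉ S.disjSum S,
      bipartizedMatrix (pwitWeight a ε) z p q ≠ 0 →
      (∃ u k, p = Sum.inl u ∧ q = Sum.inr (k :: u)) ∨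
        ∃ u k, p = Sum.inr u ∧ q = Sum.inl (k :: u) := by
    rintro (u | u) hp (v | v) hq hpq
    · exact absurd rfl hpq
    · rw [Finset.inl_mem_disjSum] at hp
      rw [Finset.inr_mem_disjSum] at hq
      simp only [bipartizedMatrix, if_neg (hne u hp v hq), sub_zero] at hpq
      obtain ⟨k, rfl⟩ := hstep u hp v hq (Or.inl hpq)
      exact Or.inl ⟨u, k, rfl, rfl⟩
    · rw [Finset.inr_mem_disjSum] at hp
      rw [Finset.inl_mem_disjSum] at hq
      simp only [bipartizedMatrix, if_neg (hne u hp v hq).symm, sub_zero] at hpq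
      obtain ⟨k, rfl⟩ := hstep u hp v hq (Or.inr fun e => hpq (by rw [e, map_zero]))
      exact Or.inr ⟨u, k, rfl, rfl⟩
    · exact absurd rfl hpq
  have hsum : ∀ (p : Word ⊕ Word) (u : Word) (i : ℕ → Word ⊕ Word), i.Injective →
      (∀ q ∉ S.disjSum S, q ∉ Set.range i → bipartizedMatrix (pwitWeight a ε) z p q = 0) →
      (∀ k, i k ∉ S.disjSum S → ¬ h u k) →
      (∀ k, i k ∉ S.disjSum S → ‖bipartizedMatrix (pwitWeight a ε) z p (i k)‖ ≤ ‖a u k‖) →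
      ∀ G : Finset (Word ⊕ Word), Disjoint (S.disjSum S) G →
        ∑ q ∈ G, ‖bipartizedMatrix (pwitWeight a ε) z p q‖ ^ 2 ≤ κ := by
    intro p u i hi h0 hl hle G hG
    have hG' : ∀ q ∈ G, q ∉ S.disjSum S := fun q hq => Finset.disjoint_right.1 hG hq
    rw [← Finset.sum_preimage i G hi.injOn
      (fun q => ‖bipartizedMatrix (pwitWeight a ε) z p q‖ ^ 2)
      (fun q hq hqi => by rw [h0 q (hG' q hq) hqi]; simp)]
    refine (Finset.sum_le_sum fun k hk => ?_).trans
      (hκ u (G.preimage i hi.injOn) fun k hk => hl k (hG' _ (Finset.mem_preimage.1 hk)))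
    exact pow_le_pow_left₀ (norm_nonneg _) (hle k (hG' _ (Finset.mem_preimage.1 hk))) 2
  have hcons : ∀ (u : Word) (k : ℕ), u ≠ k :: u := fun u k e => by
    have := congrArg List.length e
    simp at this
  constructor
  · rintro (u | u) hp G hG
    · have hu : u ∈ S := Finset.inl_mem_disjSum.1 hp
      refine hsum _ u (fun k => Sum.inr (k :: u)) ?_ ?_ ?_ ?_ G hG
      · exact fun i j e => (List.cons.inj (Sum.inr_injective e)).1
      · intro q hq hq'
        by_contra h1
        rcases hmatrix _ hp q hq h1 with ⟨u', k, e1, e2⟩ | ⟨u', k, e1, e2⟩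
        · cases e1
          exact hq' ⟨k, e2.symm⟩
        · cases e1
      · intro k hk hh
        exact hk (Finset.inr_mem_disjSum.2 (hheavy u hu k hh))
      · intro k _
        simp only [bipartizedMatrix, if_neg (hcons u k), sub_zero]
        exact norm_pwitWeight_self_cons_le a ε u k
    · have hu : u ∈ S := Finset.inr_mem_disjSum.1 hp
      refine hsum _ u (fun k => Sum.inl (k :: u)) ?_ ?_ ?_ ?_ G hG
      · exact fun i j e => (List.cons.inj (Sum.inl_injective e)).1
      · intro q hq hq'
        by_contra h1
        rcases hmatrix _ hp q hq h1 with ⟨u', k, e1, e2⟩ | ⟨u', k, e1, e2⟩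
        · cases e1
        · cases e1
          exact hq' ⟨k, e2.symm⟩
      · intro k hk hh
        exact hk (Finset.inl_mem_disjSum.2 (hheavy u hu k hh))
      · intro k _
        simp only [bipartizedMatrix, if_neg (hcons u k).symm, sub_zero, RCLike.norm_conj]
        exact norm_pwitWeight_cons_self_le a ε u k
  · intro q hq p hp p' hp' h1 h2
    rcases hmatrix p hp q hq h1 with ⟨u, k, rfl, rfl⟩ | ⟨u, k, rfl, rfl⟩ <;>
      rcases hmatrix p' hp' _ hq h2 with ⟨u', k', rfl, e⟩ | ⟨u', k', rfl, e⟩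
    · cases e; rfl
    · cases e
    · cases e
    · cases e; rfl

theorem isSelfAdjoint_closure_bipartizedOperator
    (hw : SquareSummable (pwitWeight a ε)) (hκ0 : 0 ≤ κ)
    (hκ : ∀ u, ∀ K : Finset ℕ, (∀ k ∈ K, ¬ h u k) → ∑ k ∈ K, ‖a u k‖ ^ 2 ≤ κ)
    (hfin : ∀ v, {s | IsHeavyPath h v s}.Finite) (z : ℂ) :
    IsSelfAdjoint (bipartizedOperator _ hw z).closure := by
  classical
  refine isSelfAdjoint_closure_matrixOperator (κ := κ) _ (conj_bipartizedMatrix _ z) hκ0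
    fun F => ?_
  obtain ⟨S, hFS, hparent, hheavy⟩ := exists_finset_closed hfin (F.image (Sum.elim id id))
  refine ⟨S.disjSum S, ?_, hasThinBoundary_bipartizedMatrix hκ hparent hheavy z⟩
  rintro (u | u) hu
  · exact Finset.inl_mem_disjSum.2 (hFS (Finset.mem_image.2 ⟨_, hu, rfl⟩))
  · exact Finset.inr_mem_disjSum.2 (hFS (Finset.mem_image.2 ⟨_, hu, rfl⟩))

theorem summable_of_finite_heavy {c : ℕ → ℝ} (hc : ∀ k, 0 ≤ c k) {h : ℕ → Prop}
    (hκ : ∀ K : Finset ℕ, (∀ k ∈ K, ¬ h k) → ∑ k ∈ K, c k ≤ κ) (hfin : {k | h k}.Finite) :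
    Summable c := by
  classical
  have h1 : Summable fun k => if h k then 0 else c k := by
    refine summable_of_sum_le (c := κ) (fun k => ?_) fun K => ?_
    · split_ifs <;> simp [hc]
    · have h2 := hκ (K.filter fun k => ¬ h k) fun k hk => (Finset.mem_filter.1 hk).2
      rw [Finset.sum_filter] at h2
      simpa only [ite_not] using h2
  refine h1.congr_cofinite (hfin.subset fun k hk => ?_)
  by_contra h3
  exact hk (if_neg h3)

end Bipartized

/-! ### Subcritical heavy paths are finite in number -/

theorem ENNReal.tsum_list {α : Type*} (f : List α → ℝ≥0∞) :
    ∑' s, f s = f [] + ∑' s, ∑' k, f (k :: s) := by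
  classical
  rw [ENNReal.tsum_eq_add_tsum_ite []]
  congr 1
  have hinj : Function.Injective (fun x : List α × α => x.2 :: x.1) := by
    rintro ⟨s, k⟩ ⟨s', k'⟩ h
    obtain ⟨h1, h2⟩ := List.cons.inj h
    exact Prod.ext h2 h1
  let g : List α → ℝ≥0∞ := fun s => s.casesOn 0 fun k s => f (k :: s)
  refine (tsum_congr (g := g) (by rintro (_ | ⟨k, s⟩) <;> simp [g])).trans ?_
  rw [← hinj.tsum_eq (f := g), ENNReal.tsum_prod']
  intro s hs
  rcases s with _ | ⟨k, s⟩
  · exact absurd rfl hs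
  · exact ⟨(s, k), rfl⟩

/-- The total-progeny bound for a branching process. Truncation by length allows an induction in
which `M` is a supersolution of `m = 1 + c * m`, so no infinite quantity is subtracted. -/
theorem ENNReal.tsum_list_le_of_subcritical {α : Type*} (f : List α → ℝ≥0∞) {c M : ℝ≥0∞}
    (h0 : f [] ≤ 1) (hM : 1 + c * M ≤ M)
    (hf : ∀ s, ∑' k, f (k :: s) ≤ c * f s) : ∑' s, f s ≤ M := by
  have hn : ∀ n : ℕ, ∑' s : List α, (if s.length < n then f s else 0) ≤ M := by
    intro n
    induction n with
    | zero => simp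
    | succ n ih =>
      rw [ENNReal.tsum_list]
      refine le_trans (add_le_add (b := 1) (d := c * M) ?_ ?_) hM
      · simpa using h0
      · refine le_trans ?_ (mul_le_mul_right ih c)
        rw [← ENNReal.tsum_mul_left]
        refine ENNReal.tsum_le_tsum fun s => ?_
        by_cases hs : s.length < n
        · simpa [hs] using hf s
        · simp [hs]
  rw [ENNReal.tsum_eq_iSup_sum]
  refine iSup_le fun F => ?_
  obtain ⟨n, hFn⟩ : ∃ n, ∀ s ∈ F, s.length < n :=
    ⟨F.sup List.length + 1, fun s hs => Nat.lt_succ_of_le (Finset.le_sup hs)⟩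
  calc ∑ s ∈ F, f s = ∑ s ∈ F, (if s.length < n then f s else 0) :=
        Finset.sum_congr rfl fun s hs => by rw [if_pos (hFn s hs)]
    _ ≤ _ := ENNReal.sum_le_tsum F
    _ ≤ M := hn n

section HeavyPath

variable {Ω E : Type*} [MeasurableSpace E] {X : Word → Ω → E} {H : ℕ → Set E}

/-- Heaviness of a path depends only on marks at words strictly shorter than its endpoint, hence is
independent of the marks at the endpoint. -/
theorem measurableSet_isHeavyPath (hH : ∀ k, MeasurableSet (H k)) (v s : Word) :
    MeasurableSet[⨆ u ∈ {u : Word | u.length < (s ++ v).length},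
      MeasurableSpace.comap (X u) inferInstance]
      {x | IsHeavyPath (fun u k => X u x ∈ H k) v s} := by
  induction s with
  | nil => simp [IsHeavyPath]
  | cons k s ih =>
    have h1 : {x | IsHeavyPath (fun u k => X u x ∈ H k) v (k :: s)} =
        {x | IsHeavyPath (fun u k => X u x ∈ H k) v s} ∩ X (s ++ v) ⁻¹' H k := rfl
    rw [h1]
    refine MeasurableSet.inter ?_ ?_
    · have hle : (⨆ u ∈ {u : Word | u.length < (s ++ v).length},
          MeasurableSpace.comap (X u) inferInstance) ≤
          ⨆ u ∈ {u : Word | u.length < (k :: s ++ v).length},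
            MeasurableSpace.comap (X u) inferInstance :=
        biSup_mono fun u (hu : u.length < (s ++ v).length) =>
          hu.trans (by simp only [List.cons_append, List.length_cons]; omega)
      exact hle _ ih
    · have hle : MeasurableSpace.comap (X (s ++ v)) inferInstance ≤
          ⨆ u ∈ {u : Word | u.length < (k :: s ++ v).length},
            MeasurableSpace.comap (X u) inferInstance :=
        le_biSup (fun u => MeasurableSpace.comap (X u) inferInstance)
          (show (s ++ v).length < (k :: s ++ v).length by
            simp only [List.cons_append, List.length_cons]; omega)
      exact hle _ ⟨H k, hH k, rfl⟩

theorem measure_isHeavyPath_cons [MeasurableSpace Ω] {P : Measure Ω}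
    [IsProbabilityMeasure P] (hX : ∀ v, Measurable (X v)) (hind : iIndepFun X P)
    (hH : ∀ k, MeasurableSet (H k)) (v s : Word) (k : ℕ) :
    P {x | IsHeavyPath (fun u k => X u x ∈ H k) v (k :: s)} =
      P {x | IsHeavyPath (fun u k => X u x ∈ H k) v s} * P (X (s ++ v) ⁻¹' H k) := by
  have h1 := indep_iSup_of_disjoint (fun u => (hX u).comap_le)
    ((iIndepFun_iff_iIndep _ _ _).1 hind)
    (S := {u : Word | u.length < (s ++ v).length}) (T := {s ++ v})
    (Set.disjoint_singleton_right.2 (lt_irrefl (s ++ v).length))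
  refine (Indep_iff _ _ _).1 h1 _ _ (measurableSet_isHeavyPath hH v s) ?_
  have hle : MeasurableSpace.comap (X (s ++ v)) inferInstance ≤
      ⨆ u ∈ ({s ++ v} : Set Word), MeasurableSpace.comap (X u) inferInstance :=
    le_biSup (fun u => MeasurableSpace.comap (X u) inferInstance) (Set.mem_singleton _)
  exact hle _ ⟨H k, hH k, rfl⟩

theorem ae_finite_isHeavyPath [MeasurableSpace Ω] {P : Measure Ω}
    [IsProbabilityMeasure P] (hX : ∀ v, Measurable (X v)) (hind : iIndepFun X P)
    (hH : ∀ k, MeasurableSet (H k)) {c M : ℝ≥0∞} (hM : 1 + c * M ≤ M) (hM' : M ≠ ∞)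
    (hc : ∀ v, ∑' k, P (X v ⁻¹' H k) ≤ c) :
    ∀ᵐ x ∂P, ∀ v, {s | IsHeavyPath (fun u k => X u x ∈ H k) v s}.Finite := by
  rw [ae_all_iff]
  intro v
  refine ae_finite_setOfPred_mem (s := fun s => {x | IsHeavyPath (fun u k => X u x ∈ H k) v s})
    (ne_top_of_le_ne_top hM' ?_)
  refine ENNReal.tsum_list_le_of_subcritical _ prob_le_one hM fun s => ?_
  simp only [measure_isHeavyPath_cons hX hind hH]
  rw [ENNReal.tsum_mul_left, mul_comm]
  exact mul_le_mul_left (hc _) _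

end HeavyPath

/-! ### Moments of the Poisson distribution -/

theorem lintegral_poissonMeasure (r : ℝ≥0) (f : ℕ → ℝ≥0∞) :
    ∫⁻ n, f n ∂poissonMeasure r =
      ∑' n, ENNReal.ofReal (Real.exp (-r) * r ^ n / n.factorial) * f n := by
  rw [poissonMeasure, lintegral_sum_measure]
  simp

theorem lintegral_pow_poissonMeasure (r : ℝ≥0) (t : ℕ) :
    ∫⁻ n, (t : ℝ≥0∞) ^ n ∂poissonMeasure r = ENNReal.ofReal (Real.exp (r * (t - 1))) := by
  rw [lintegral_poissonMeasure]
  have h1 : HasSum (fun n : ℕ => Real.exp (-r) * ((r * t : ℝ) ^ n / n.factorial))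
      (Real.exp (-r) * Real.exp (r * t)) := by
    have h2 := (NormedSpace.expSeries_div_hasSum_exp (r * t : ℝ)).mul_left (Real.exp (-r))
    rwa [← Real.exp_eq_exp_ℝ] at h2
  rw [← Real.exp_add] at h1
  rw [show (r : ℝ) * (t - 1) = -r + r * t by ring, ← h1.tsum_eq,
    ENNReal.ofReal_tsum_of_nonneg (fun n => by positivity) h1.summable]
  refine tsum_congr fun n => ?_
  rw [← ENNReal.ofReal_natCast, ← ENNReal.ofReal_pow (by positivity),
    ← ENNReal.ofReal_mul (by positivity), mul_pow]
  congr 1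
  ring

/-- Integrate `n + 1 ≤ 2 ^ n`. The resulting crude bound `exp r - 1` for the mean suffices. -/
theorem lintegral_id_poissonMeasure_add_one_le (r : ℝ≥0) :
    ∫⁻ n, (n : ℝ≥0∞) ∂poissonMeasure r + 1 ≤ ENNReal.ofReal (Real.exp r) := by
  have h1 := lintegral_pow_poissonMeasure r 2
  rw [show (r : ℝ) * ((2 : ℕ) - 1) = r by push_cast; ring] at h1
  rw [← h1]
  calc ∫⁻ n, (n : ℝ≥0∞) ∂poissonMeasure r + 1
      = ∫⁻ n, ((n : ℝ≥0∞) + 1) ∂poissonMeasure r := by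
        rw [lintegral_add_right _ measurable_const]; simp
    _ ≤ _ := lintegral_mono fun n => by
        have h2 : ((n + 1 : ℕ) : ℝ≥0∞) ≤ ((2 ^ n : ℕ) : ℝ≥0∞) :=
          Nat.cast_le.2 (Nat.succ_le_of_lt Nat.lt_two_pow_self)
        push_cast at h2 ⊢
        exact h2

/-- For `n > T`, `n * 2 ^ T ≤ 2 ^ n * 2 ^ n = 4 ^ n`, whose Poisson expectation is `exp (3 * r)`. -/
theorem lintegral_truncated_poissonMeasure_le (r : ℝ≥0) (T : ℕ) :
    ∫⁻ n, (if (T : ℝ≥0∞) < n then (n : ℝ≥0∞) else 0) ∂poissonMeasure r ≤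
      ENNReal.ofReal (Real.exp (3 * r) / 2 ^ T) := by
  have h1 := lintegral_pow_poissonMeasure r 4
  rw [show (r : ℝ) * ((4 : ℕ) - 1) = 3 * r by push_cast; ring] at h1
  rw [ENNReal.ofReal_div_of_pos (by positivity), ← h1, ENNReal.div_eq_inv_mul,
    ← lintegral_const_mul _ (measurable_of_countable _)]
  refine lintegral_mono fun n => ?_
  dsimp only
  split_ifs with h
  · rw [← ENNReal.div_eq_inv_mul, ENNReal.le_div_iff_mul_le (by simp) (by simp)]
    rw [ENNReal.ofReal_pow (by norm_num)]
    have h2 : n * 2 ^ T ≤ 4 ^ n := by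
      rw [show 4 = 2 * 2 by rfl, mul_pow]
      exact Nat.mul_le_mul (Nat.lt_two_pow_self).le
        (Nat.pow_le_pow_right (by norm_num) (by exact_mod_cast h.le))
    have h3 : ENNReal.ofReal 2 = ((2 : ℕ) : ℝ≥0∞) := by simp
    rw [h3]
    exact_mod_cast h2
  · exact zero_le

/-! ### The intensity measure -/

/-- The factor `ω ^ (-α)` has modulus one, so the modulus pushes the measure to Lebesgue measure on
the half-line, whatever `θ` is. -/
theorem ellTheta_preimage_norm (α : ℝ) (θ : Measure (Metric.sphere (0 : ℂ) 1))
    [IsProbabilityMeasure θ] {I : Set ℝ} (hI : MeasurableSet I) :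
    ellTheta α θ (norm ⁻¹' I) = volume (I ∩ Set.Ioi 0) := by
  have hmeas : Measurable fun p : ℝ × Metric.sphere (0 : ℂ) 1 =>
      (p.2 : ℂ) ^ (-α : ℂ) * (p.1 : ℂ) :=
    ((measurable_subtype_coe.comp measurable_snd).pow_const _).mul
      (Complex.measurable_ofReal.comp measurable_fst)
  rw [ellTheta, Measure.map_apply hmeas (measurable_norm hI)]
  have h1 : (fun p : ℝ × Metric.sphere (0 : ℂ) 1 => (p.2 : ℂ) ^ (-α : ℂ) * (p.1 : ℂ)) ⁻¹'
      (norm ⁻¹' I) = ((fun r : ℝ => |r|) ⁻¹' I) ×ˢ Set.univ := by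
    ext p
    have h2 : ‖(p.2 : ℂ) ^ (-α : ℂ)‖ = 1 := by
      have h3 : ‖(p.2 : ℂ)‖ = 1 := by simp
      rw [← Complex.ofReal_neg, Complex.norm_cpow_real, h3, Real.one_rpow]
    simp [h2]
  rw [h1, Measure.prod_prod, measure_univ, mul_one,
    Measure.restrict_apply (show MeasurableSet ((fun r : ℝ => |r|) ⁻¹' I) from measurable_norm hI)]
  congr 1
  ext r
  simp only [Set.mem_inter_iff, Set.mem_preimage, Set.mem_Ioi]
  exact and_congr_left fun hr => by rw [abs_of_pos hr]

theorem bernoulliHalf_univ : bernoulliHalf Set.univ = 1 := by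
  simp [bernoulliHalf, ENNReal.inv_two_add_inv_two]

/-- The marks with modulus in `I`. -/
def normShell (I : Set ℝ) : Set (ℂ × Fin 2) := {p | ‖p.1‖ ∈ I}

theorem measurableSet_normShell {I : Set ℝ} (hI : MeasurableSet I) :
    MeasurableSet (normShell I) :=
  (measurable_norm.comp measurable_fst) hI

theorem intensity_normShell (α : ℝ) (θ : Measure (Metric.sphere (0 : ℂ) 1))
    [IsProbabilityMeasure θ] {I : Set ℝ} (hI : MeasurableSet I) :
    (((2 : ℝ≥0∞) • ellTheta α θ).prod bernoulliHalf) (normShell I) =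
      2 * volume (I ∩ Set.Ioi 0) := by
  have : IsProbabilityMeasure bernoulliHalf := ⟨bernoulliHalf_univ⟩
  have h1 : normShell I = (norm ⁻¹' I) ×ˢ Set.univ := by
    ext p; simp [normShell]
  rw [h1, Measure.prod_prod, bernoulliHalf_univ, mul_one, Measure.smul_apply,
    ellTheta_preimage_norm α θ hI, smul_eq_mul]

/-! ### Heavy marks -/

/-- The number of terms of the sequence `η` in `D`. -/
noncomputable def pointCount {E : Type*} (η : ℕ → E) (D : Set E) : ℝ≥0∞ :=
  ∑' k, D.indicator 1 (η k)

theorem sum_dirac_apply {E : Type*} [MeasurableSpace E] (η : ℕ → E) {D : Set E}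
    (hD : MeasurableSet D) : (Measure.sum fun k => Measure.dirac (η k)) D = pointCount η D := by
  rw [Measure.sum_apply _ hD]
  exact tsum_congr fun k => Measure.dirac_apply' _ hD

theorem measurable_pointCount {E : Type*} [MeasurableSpace E] {D : Set E}
    (hD : MeasurableSet D) : Measurable fun η : ℕ → E => pointCount η D :=
  Measurable.tsum fun k => (measurable_one.indicator hD).comp (measurable_pi_apply k)

/-- The marks with modulus in the `j`-th dyadic interval. -/
def dyadicShell (j : ℕ) : Set (ℂ × Fin 2) := normShell (Set.Ico (2 ^ j / 8) (2 ^ (j + 1) / 8))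

theorem measurableSet_dyadicShell (j : ℕ) : MeasurableSet (dyadicShell j) :=
  measurableSet_normShell measurableSet_Ico

/-- The sequences whose `k`-th mark is small or lies in an overcrowded dyadic shell. -/
def heavySet (k : ℕ) : Set (ℕ → ℂ × Fin 2) :=
  {η | η k ∈ normShell (Set.Iio (1 / 8)) ∨
    ∃ j, η k ∈ dyadicShell j ∧ ((4 * 2 ^ j : ℕ) : ℝ≥0∞) < pointCount η (dyadicShell j)}

theorem measurableSet_heavySet (k : ℕ) : MeasurableSet (heavySet k) := by
  have h1 : heavySet k = (fun η => η k) ⁻¹' normShell (Set.Iio (1 / 8)) ∪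
      ⋃ j, ((fun η => η k) ⁻¹' dyadicShell j ∩
        (fun η => pointCount η (dyadicShell j)) ⁻¹' Set.Ioi ((4 * 2 ^ j : ℕ) : ℝ≥0∞)) := by
    ext η
    simp [heavySet]
  rw [h1]
  refine ((measurable_pi_apply k) (measurableSet_normShell measurableSet_Iio)).union
    (MeasurableSet.iUnion fun j => MeasurableSet.inter ?_ ?_)
  · exact (measurable_pi_apply k) (measurableSet_dyadicShell j)
  · exact measurable_pointCount (measurableSet_dyadicShell j) measurableSet_Ioi

theorem exists_mem_dyadicShell {p : ℂ × Fin 2} (hp : p ∉ normShell (Set.Iio (1 / 8))) :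
    ∃ j, p ∈ dyadicShell j := by
  have h1 : (1 : ℝ) ≤ 8 * ‖p.1‖ := by
    have h2 : ¬ ‖p.1‖ < 1 / 8 := hp
    linarith
  obtain ⟨j, hj, hj'⟩ := exists_nat_pow_near h1 one_lt_two
  refine ⟨j, ?_, ?_⟩ <;> linarith

theorem card_le_pointCount {E : Type*} {η : ℕ → E} {D : Set E} {K : Finset ℕ}
    (hK : ∀ k ∈ K, η k ∈ D) : (K.card : ℝ≥0∞) ≤ pointCount η D := by
  refine le_trans (le_of_eq ?_) (ENNReal.sum_le_tsum K)
  rw [Finset.sum_congr rfl fun k hk => Set.indicator_of_mem (hK k hk) _]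
  simp

/-- A bound for the sum of `‖y‖ ^ (-s)` over the marks that are not heavy. -/
noncomputable def lightBound (s : ℝ) : ℝ := ∑' j : ℕ, 4 * 2 ^ j * ((2 : ℝ) ^ j / 8) ^ (-s)

/-- A geometric series of ratio `2 ^ (1 - s)`. -/
theorem summable_lightBound {s : ℝ} (hs : 1 < s) :
    Summable fun j : ℕ => 4 * 2 ^ j * ((2 : ℝ) ^ j / 8) ^ (-s) := by
  have h1 : ∀ j : ℕ, 4 * 2 ^ j * ((2 : ℝ) ^ j / 8) ^ (-s) =
      4 * 8 ^ s * ((2 : ℝ) ^ (1 - s)) ^ j := by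
    intro j
    rw [Real.div_rpow (by positivity) (by norm_num), Real.rpow_neg (by norm_num : (0 : ℝ) ≤ 8),
      div_inv_eq_mul, sub_eq_add_neg, Real.rpow_add two_pos, Real.rpow_one, mul_pow,
      Real.rpow_pow_comm two_pos.le]
    ring
  simp only [h1]
  refine (summable_geometric_of_lt_one (by positivity) ?_).mul_left _
  exact Real.rpow_lt_one_of_one_lt_of_neg one_lt_two (by linarith)

/-- Each mark that is not heavy lies in an uncrowded shell; shell `j` contributes at most `4 * 2 ^
j` such marks, of modulus at least `2 ^ j / 8`. The bound involves no randomness and so is uniform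
over vertices. -/
theorem sum_norm_rpow_le_lightBound {s : ℝ} (hs : 1 < s) {η : ℕ → ℂ × Fin 2} {K : Finset ℕ}
    (hK : ∀ k ∈ K, η ∉ heavySet k) : ∑ k ∈ K, ‖(η k).1‖ ^ (-s) ≤ lightBound s := by
  classical
  have hex : ∀ k, ∃ j, k ∈ K → η k ∈ dyadicShell j := by
    intro k
    by_cases hk : k ∈ K
    · obtain ⟨j, hj⟩ := exists_mem_dyadicShell fun h => hK k hk (Or.inl h)
      exact ⟨j, fun _ => hj⟩
    · exact ⟨0, fun h => absurd h hk⟩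
  choose j hj using hex
  rw [← Finset.sum_fiberwise_of_maps_to (t := K.image j) (g := j)
    fun k hk => Finset.mem_image_of_mem j hk]
  refine le_trans (Finset.sum_le_sum fun i _ => ?_)
    ((summable_lightBound hs).sum_le_tsum (K.image j) fun i _ => by positivity)
  have h1 : ∀ k ∈ K.filter (fun k => j k = i), ‖(η k).1‖ ^ (-s) ≤ ((2 : ℝ) ^ i / 8) ^ (-s) := by
    intro k hk
    rw [Finset.mem_filter] at hk
    have h2 := (hj k hk.1).1
    rw [hk.2] at h2
    exact Real.rpow_le_rpow_of_nonpos (by positivity) h2 (by linarith)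
  refine (Finset.sum_le_card_nsmul _ _ _ h1).trans ?_
  rw [nsmul_eq_mul]
  refine mul_le_mul_of_nonneg_right ?_ (by positivity)
  rcases (K.filter fun k => j k = i).eq_empty_or_nonempty with h0 | ⟨k, hk⟩
  · rw [h0]; simp
  · rw [Finset.mem_filter] at hk
    have h3 : pointCount η (dyadicShell i) ≤ ((4 * 2 ^ i : ℕ) : ℝ≥0∞) := by
      by_contra h4
      exact hK k hk.1 (Or.inr ⟨i, hk.2 ▸ hj k hk.1, not_le.1 h4⟩)
    have h5 : ((K.filter fun k => j k = i).card : ℝ≥0∞) ≤ ((4 * 2 ^ i : ℕ) : ℝ≥0∞) := by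
      refine (card_le_pointCount fun k hk => ?_).trans h3
      rw [Finset.mem_filter] at hk
      exact hk.2 ▸ hj k hk.1
    have h6 : (K.filter fun k => j k = i).card ≤ 4 * 2 ^ i := by exact_mod_cast h5
    exact_mod_cast h6

/-! ### The expected number of heavy marks -/

section Expectation

variable {Ω E : Type*} [MeasurableSpace Ω] [MeasurableSpace E] {P : Measure Ω} {ξ : ℕ → Ω → E}
  {μ : Measure E}

theorem lintegral_pointCount
    (hN : IsPoissonProcess (fun x => Measure.sum fun k => Measure.dirac (ξ k x)) μ P)
    {D : Set E} (hD : MeasurableSet D) (hξ : ∀ k, Measurable (ξ k)) (hμ : μ D ≠ ∞)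
    {g : ℝ≥0∞ → ℝ≥0∞} (hg : Measurable g) :
    ∫⁻ x, g (pointCount (fun k => ξ k x) D) ∂P =
      ∫⁻ n, g (n : ℝ≥0∞) ∂poissonMeasure (μ D).toNNReal := by
  have h1 : Measurable fun x => pointCount (fun k => ξ k x) D :=
    (measurable_pointCount hD).comp (measurable_pi_lambda _ hξ)
  have h2 := hN.count_law D hD hμ
  simp only [sum_dirac_apply _ hD] at h2
  rw [← lintegral_map (f := g) hg h1, h2, lintegral_map hg (measurable_of_countable _)]

theorem tsum_measure_mem_eq_lintegral {D : Set E} (hD : MeasurableSet D)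
    (hξ : ∀ k, Measurable (ξ k)) {A : Set Ω} (hA : MeasurableSet A) :
    ∑' k, P (ξ k ⁻¹' D ∩ A) =
      ∫⁻ x, A.indicator (fun x => pointCount (fun k => ξ k x) D) x ∂P := by
  have h1 : ∀ x, A.indicator (fun x => pointCount (fun k => ξ k x) D) x =
      ∑' k, (ξ k ⁻¹' D ∩ A).indicator 1 x := by
    intro x
    by_cases hx : x ∈ A
    · rw [Set.indicator_of_mem hx]
      refine tsum_congr fun k => ?_
      by_cases hk : ξ k x ∈ D
      · rw [Set.indicator_of_mem hk, Set.indicator_of_mem (show x ∈ ξ k ⁻¹' D ∩ A from ⟨hk, hx⟩)]; rfl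
      · rw [Set.indicator_of_notMem hk, Set.indicator_of_notMem fun h : x ∈ ξ k ⁻¹' D ∩ A => hk h.1]
    · simp [hx]
  have hm : ∀ k, MeasurableSet (ξ k ⁻¹' D ∩ A) := fun k => (hξ k hD).inter hA
  rw [lintegral_congr h1, lintegral_tsum fun k => (measurable_one.indicator (hm k)).aemeasurable]
  exact tsum_congr fun k => (lintegral_indicator_one (hm k)).symm

end Expectation

theorem exp_quarter_le : Real.exp (1 / 4) ≤ 4 / 3 := by
  have h1 : Real.exp (1 / 4) ^ 4 = Real.exp 1 := by
    rw [← Real.exp_nat_mul]; norm_num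
  have h2 := Real.exp_one_lt_d9
  -- Reduces to `e ≤ (4 / 3) ^ 4 = 256 / 81`.
  refine le_of_pow_le_pow_left₀ (n := 4) (by norm_num) (by norm_num) ?_
  rw [h1]
  norm_num at h2 ⊢
  linarith

section Heavy

variable {Ω : Type*} [MeasurableSpace Ω] {P : Measure Ω} {ξ : ℕ → Ω → ℂ × Fin 2} {α : ℝ}
  {θ : Measure (Metric.sphere (0 : ℂ) 1)} [IsProbabilityMeasure θ]

/-- The disc of radius 1/8 has intensity 1/4, and `exp (1 / 4) - 1 ≤ 1 / 3`. -/
theorem tsum_measure_core_le (hξ : ∀ k, Measurable (ξ k))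
    (hN : IsPoissonProcess (fun x => Measure.sum fun k => Measure.dirac (ξ k x))
      (((2 : ℝ≥0∞) • ellTheta α θ).prod bernoulliHalf) P) :
    ∑' k, P (ξ k ⁻¹' normShell (Set.Iio (1 / 8))) ≤ ENNReal.ofReal (1 / 3) := by
  have hD : MeasurableSet (normShell (Set.Iio (1 / 8))) := measurableSet_normShell measurableSet_Iio
  have h1 := tsum_measure_mem_eq_lintegral (P := P) hD hξ MeasurableSet.univ
  simp only [Set.inter_univ, Set.indicator_univ] at h1
  have h2 : (((2 : ℝ≥0∞) • ellTheta α θ).prod bernoulliHalf) (normShell (Set.Iio (1 / 8))) =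
      ENNReal.ofReal (1 / 4) := by
    rw [intensity_normShell α θ measurableSet_Iio, Set.Iio_inter_Ioi, Real.volume_Ioo,
      ← ENNReal.ofReal_ofNat 2, ← ENNReal.ofReal_mul (by norm_num)]
    norm_num
  have h0 := lintegral_pointCount hN hD hξ (by rw [h2]; simp) measurable_id
  simp only [id] at h0
  rw [h1, h0, h2]
  have h3 := lintegral_id_poissonMeasure_add_one_le (ENNReal.ofReal (1 / 4)).toNNReal
  have h4 : (((ENNReal.ofReal (1 / 4)).toNNReal : ℝ≥0) : ℝ) = 1 / 4 := by
    rw [ENNReal.coe_toNNReal_eq_toReal, ENNReal.toReal_ofReal (by norm_num)]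
  rw [h4] at h3
  have h5 : ENNReal.ofReal (Real.exp (1 / 4)) ≤ ENNReal.ofReal (1 / 3) + 1 := by
    rw [← ENNReal.ofReal_one, ← ENNReal.ofReal_add (by norm_num) (by norm_num)]
    refine ENNReal.ofReal_le_ofReal (exp_quarter_le.trans (by norm_num))
  exact (ENNReal.add_le_add_iff_right ENNReal.one_ne_top).1 (h3.trans h5)

/-- Shell `j` has intensity `2 ^ j / 4`, a sixteenth of the threshold. The truncated moment bound
gives `(exp (3 / 4) / 16) ^ (2 ^ j)`, and `exp (3 / 4) ≤ 4`. -/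
theorem tsum_measure_crowded_shell_le (hξ : ∀ k, Measurable (ξ k))
    (hN : IsPoissonProcess (fun x => Measure.sum fun k => Measure.dirac (ξ k x))
      (((2 : ℝ≥0∞) • ellTheta α θ).prod bernoulliHalf) P) (j : ℕ) :
    ∑' k, P (ξ k ⁻¹' dyadicShell j ∩
      {x | ((4 * 2 ^ j : ℕ) : ℝ≥0∞) < pointCount (fun k => ξ k x) (dyadicShell j)}) ≤
      ENNReal.ofReal ((1 / 4) ^ (j + 1)) := by
  have hD := measurableSet_dyadicShell j
  have hA : MeasurableSet
      {x | ((4 * 2 ^ j : ℕ) : ℝ≥0∞) < pointCount (fun k => ξ k x) (dyadicShell j)} :=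
    ((measurable_pointCount hD).comp (measurable_pi_lambda _ hξ)) measurableSet_Ioi
  have h1 := tsum_measure_mem_eq_lintegral (P := P) hD hξ hA
  set g : ℝ≥0∞ → ℝ≥0∞ := fun t => if ((4 * 2 ^ j : ℕ) : ℝ≥0∞) < t then t else 0
  have hg : Measurable g := Measurable.ite measurableSet_Ioi measurable_id measurable_const
  have hI : Set.Ico ((2 : ℝ) ^ j / 8) (2 ^ (j + 1) / 8) ∩ Set.Ioi 0 =
      Set.Ico ((2 : ℝ) ^ j / 8) (2 ^ (j + 1) / 8) :=
    Set.inter_eq_left.2 fun r hr => lt_of_lt_of_le (by positivity) hr.1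
  have h2 : (((2 : ℝ≥0∞) • ellTheta α θ).prod bernoulliHalf) (dyadicShell j) =
      ENNReal.ofReal (2 ^ j / 4) := by
    rw [dyadicShell, intensity_normShell α θ measurableSet_Ico, hI, Real.volume_Ico,
      ← ENNReal.ofReal_ofNat 2, ← ENNReal.ofReal_mul (by norm_num)]
    congr 1
    ring
  have h3 : ∀ x, Set.indicator
      {x | ((4 * 2 ^ j : ℕ) : ℝ≥0∞) < pointCount (fun k => ξ k x) (dyadicShell j)}
      (fun x => pointCount (fun k => ξ k x) (dyadicShell j)) x =
      g (pointCount (fun k => ξ k x) (dyadicShell j)) := fun x => by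
    simp only [g, Set.indicator_apply, Set.mem_ofPred_eq]
  rw [h1, lintegral_congr h3, lintegral_pointCount hN hD hξ (by rw [h2]; simp) hg, h2]
  refine (lintegral_truncated_poissonMeasure_le _ (4 * 2 ^ j)).trans (ENNReal.ofReal_le_ofReal ?_)
  have h4 : (((ENNReal.ofReal (2 ^ j / 4)).toNNReal : ℝ≥0) : ℝ) = 2 ^ j / 4 := by
    rw [ENNReal.coe_toNNReal_eq_toReal, ENNReal.toReal_ofReal (by positivity)]
  have h5 : Real.exp (3 * (2 ^ j / 4)) = Real.exp (3 / 4) ^ (2 ^ j) := by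
    rw [← Real.exp_nat_mul]
    congr 1
    push_cast
    ring
  have h6 : Real.exp (3 / 4) ≤ 4 := by
    have h7 := Real.exp_one_lt_d9
    have h8 : Real.exp (3 / 4) ≤ Real.exp 1 := Real.exp_le_exp.2 (by norm_num)
    norm_num at h7
    linarith
  rw [h4, h5, pow_mul, ← div_pow]
  calc (Real.exp (3 / 4) / 2 ^ 4) ^ 2 ^ j ≤ (1 / 4 : ℝ) ^ 2 ^ j := by
        refine pow_le_pow_left₀ (by positivity) ?_ _
        linarith
    _ ≤ (1 / 4) ^ (j + 1) :=
        pow_le_pow_of_le_one (by norm_num) (by norm_num) Nat.lt_two_pow_self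

theorem tsum_measure_heavySet_le (hξ : ∀ k, Measurable (ξ k))
    (hN : IsPoissonProcess (fun x => Measure.sum fun k => Measure.dirac (ξ k x))
      (((2 : ℝ≥0∞) • ellTheta α θ).prod bernoulliHalf) P) :
    ∑' k, P ((fun x k => ξ k x) ⁻¹' heavySet k) ≤ ENNReal.ofReal (2 / 3) := by
  have h1 : ∀ k, P ((fun x k => ξ k x) ⁻¹' heavySet k) ≤
      P (ξ k ⁻¹' normShell (Set.Iio (1 / 8))) + ∑' j, P (ξ k ⁻¹' dyadicShell j ∩
        {x | ((4 * 2 ^ j : ℕ) : ℝ≥0∞) < pointCount (fun k => ξ k x) (dyadicShell j)}) := by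
    intro k
    refine le_trans (measure_mono ?_) ((measure_union_le _ _).trans
      (add_le_add le_rfl (measure_iUnion_le _)))
    rintro x (hx | ⟨j, hx⟩)
    · exact Or.inl hx
    · exact Or.inr (Set.mem_iUnion.2 ⟨j, hx⟩)
  refine (ENNReal.tsum_le_tsum h1).trans ?_
  rw [ENNReal.tsum_add, ENNReal.tsum_comm]
  have h2 : HasSum (fun j : ℕ => (1 / 4 : ℝ) ^ (j + 1)) (1 / 3) := by
    have h3 := (hasSum_geometric_of_lt_one (r := (1 / 4 : ℝ)) (by norm_num) (by norm_num)).mul_left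
      (1 / 4)
    norm_num at h3
    simpa only [pow_succ', one_div] using h3
  have h4 : ∑' j : ℕ, ENNReal.ofReal ((1 / 4) ^ (j + 1)) = ENNReal.ofReal (1 / 3) := by
    rw [← ENNReal.ofReal_tsum_of_nonneg (fun j => by positivity) h2.summable, h2.tsum_eq]
  calc _ ≤ ENNReal.ofReal (1 / 3) + ENNReal.ofReal (1 / 3) :=
        add_le_add (tsum_measure_core_le hξ hN)
          ((ENNReal.tsum_le_tsum fun j => tsum_measure_crowded_shell_le hξ hN j).trans h4.le)
    _ = ENNReal.ofReal (2 / 3) := by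
        rw [← ENNReal.ofReal_add (by norm_num) (by norm_num)]
        norm_num

/-- The origin has zero intensity, so the expected number of marks there is zero. -/
theorem ae_ne_zero_of_isPoissonProcess (hξ : ∀ k, Measurable (ξ k))
    (hN : IsPoissonProcess (fun x => Measure.sum fun k => Measure.dirac (ξ k x))
      (((2 : ℝ≥0∞) • ellTheta α θ).prod bernoulliHalf) P) (k : ℕ) :
    ∀ᵐ x ∂P, (ξ k x).1 ≠ 0 := by
  have hD : MeasurableSet (normShell {0}) := measurableSet_normShell (measurableSet_singleton 0)
  have h1 := tsum_measure_mem_eq_lintegral (P := P) hD hξ MeasurableSet.univ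
  simp only [Set.inter_univ, Set.indicator_univ] at h1
  have h2 : (((2 : ℝ≥0∞) • ellTheta α θ).prod bernoulliHalf) (normShell {0}) = 0 := by
    rw [intensity_normShell α θ (measurableSet_singleton 0)]
    simp
  have h0 := lintegral_pointCount hN hD hξ (by rw [h2]; simp) measurable_id
  simp only [id] at h0
  rw [h0, h2] at h1
  have h3 := lintegral_id_poissonMeasure_add_one_le (0 : ℝ≥0∞).toNNReal
  have h4 : ∑' k, P (ξ k ⁻¹' normShell {0}) = 0 := by
    rw [h1]
    refine nonpos_iff_eq_zero.1 ((ENNReal.add_le_add_iff_right ENNReal.one_ne_top).1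
      (h3.trans ?_))
    simp
  have h5 := ENNReal.tsum_eq_zero.1 h4 k
  rw [ae_iff]
  refine measure_mono_null (fun x hx => ?_) h5
  simpa [normShell] using hx

end Heavy

/-- As the exponent is real, all values of the power share one modulus; hence the choice of branches
plays no role. -/
theorem IsPowerValue.norm_eq {α : ℝ} {y a : ℂ} (h : IsPowerValue (-1 / α : ℂ) y a) :
    ‖a‖ = ‖y‖ ^ (-1 / α) := by
  obtain ⟨l, rfl, rfl⟩ := h
  have h1 : (-1 / α : ℂ) = ((-1 / α : ℝ) : ℂ) := by push_cast; rfl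
  rw [h1, Complex.norm_exp, Complex.norm_exp, Complex.re_ofReal_mul, ← Real.exp_mul, mul_comm]

theorem proposition2p8 (α : ℝ) (hα0 : 0 < α) (hα2 : α < 2)
    (θ : Measure (Metric.sphere (0 : ℂ) 1)) [IsProbabilityMeasure θ]
    {Ω : Type*} [MeasurableSpace Ω] (P : Measure Ω) [IsProbabilityMeasure P]
    (ξ : Word → ℕ → Ω → ℂ × Fin 2)
    (hξ : IsPWIT ((2 : ℝ≥0∞) • ellTheta α θ) ξ P) :
    ∀ᵐ x ∂P,
      (∀ v k, (ξ v k x).1 ≠ 0) ∧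
      ∀ a : Word → ℕ → ℂ,
        (∀ v k, IsPowerValue (-1 / α : ℂ) (ξ v k x).1 (a v k)) →
        ∃ hw : SquareSummable (pwitWeight a fun v k => (ξ v k x).2),
          ∀ z : ℂ, IsSelfAdjoint (bipartizedOperator _ hw z).closure := by
  have hne : ∀ᵐ x ∂P, ∀ v k, (ξ v k x).1 ≠ 0 := by
    simp only [ae_all_iff]
    exact fun v k => ae_ne_zero_of_isPoissonProcess (hξ.measurable v) (hξ.poisson v) k
  have hpath := ae_finite_isHeavyPath (X := fun v x k => ξ v k x) (H := heavySet)
    -- The value 3 solves `1 + (2 / 3) * M = M`.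
    (c := ENNReal.ofReal (2 / 3)) (M := ENNReal.ofReal 3)
    (fun v => measurable_pi_lambda _ (hξ.measurable v)) hξ.indep measurableSet_heavySet
    (by
      rw [← ENNReal.ofReal_mul (by norm_num), ← ENNReal.ofReal_one,
        ← ENNReal.ofReal_add (by norm_num) (by norm_num)]
      norm_num)
    ENNReal.ofReal_ne_top fun v => tsum_measure_heavySet_le (hξ.measurable v) (hξ.poisson v)
  -- The exceptional null set is fixed before `a` and `z`, so the conclusion holds for all of them
  -- simultaneously.
  filter_upwards [hne, hpath] with x hx hfin
  refine ⟨hx, fun a ha => ?_⟩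
  -- This is where `α < 2` enters.
  have hs : 1 < 2 / α := (one_lt_div hα0).2 hα2
  have hκ : ∀ u, ∀ K : Finset ℕ, (∀ k ∈ K, ¬ (fun k => ξ u k x) ∈ heavySet k) →
      ∑ k ∈ K, ‖a u k‖ ^ 2 ≤ lightBound (2 / α) := by
    intro u K hK
    refine le_trans (le_of_eq (Finset.sum_congr rfl fun k _ => ?_))
      (sum_norm_rpow_le_lightBound hs hK)
    rw [(ha u k).norm_eq, ← Real.rpow_natCast, ← Real.rpow_mul (norm_nonneg _)]
    congr 1
    push_cast
    ring
  have hsum : ∀ u, Summable fun k => ‖a u k‖ ^ 2 := fun u => by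
    refine summable_of_finite_heavy (fun k => by positivity) (hκ u) ?_
    -- Heavy offspring of `u` are heavy paths of length one, so there are finitely many.
    refine ((hfin u).preimage (f := fun k : ℕ => [k])
      (fun i _ j _ e => (List.cons.inj e).1)).subset fun k hk => ⟨trivial, hk⟩
  exact ⟨squareSummable_pwitWeight _ hsum, isSelfAdjoint_closure_bipartizedOperator _
    (tsum_nonneg fun j => by positivity) hκ hfin⟩
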